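/- Let $a<b$ be real numbers. A Banach function lattice $X$ on $[a,b]$ (with Lebesgue measure $\mu$) is a complex vector space of measurable functions $f:[a,b]\to\mathbb{C}$, with functions equal almost everywhere identified, that contains $|f|$ together with $f$, is contained in $L_1[a,b]$, contains the indicator function of every measurable subset of $[a,b]$, and is complete with respect to a norm $\|\cdot\|_X$ such that $\|f\|_X\le\|g\|_X$ whenever $f,g\in X$ and $|f|\le|g|$ almost everywhere. It is called rearrangement invariant if $\|f\|_X=\|g\|_X$ whenever $f,g\in X$ and $\mu\{x:|f(x)|\ge y\}=\mu\{x:|g(x)|\ge y\}$ for all $y$. Let $\mathcal{P}_n$ be the set of algebraic polynomials of degree at most $n$ with complex coefficients. **(Markov inequality.)** Let $X$ be a rearrangement invariant Banach function lattice on $[a,b]$ and let $n,r\ge 0$ be integers. Then every $P\in\mathcal{P}_n$ satisfies $P,P^{(r)}\in X$ and $$\|P^{(r)}\|_X\le\left(\frac{8n^2}{b-a}\right)^r\|P\|_X,$$ where $0^0=1$. **(Marcinkiewicz–Zygmund inequality.)** For every $\varepsilon>0$ there is a constant $C>0$, depending only on $\varepsilon$, with the following property. Let $a<b$, let $X$ be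 a rearrangement invariant Banach function lattice on $[a,b]$, let $n\ge 0$ and $N\ge 1$ be integers with $N\ge\left(\frac{8}{\log 2}+\varepsilon\right)n^2$, and let $x_k$ be an arbitrary point of $\Omega_k=\left[a+\frac{(b-a)(k-1)}{N},\,a+\frac{(b-a)k}{N}\right]$, $k=1,\dots,N$. Then for every $P\in\mathcal{P}_n$ the functions $P$ and $\sum_{k=1}^N|P(x_k)|\chi_{\Omega_k}$ belong to $X$ and $$C^{-1}\Big\|\sum_{k=1}^N|P(x_k)|\chi_{\Omega_k}\Big\|_X\le\|P\|_X\le C\,\Big\|\sum_{k=1}^N|P(x_k)|\chi_{\Omega_k}\Big\|_X.$$ -/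

import Mathlib

open MeasureTheory Set

/-- A Banach function lattice `X = X(Ω, μ)` of complex-valued measurable functions, where functions
that agree `μ`-almost everywhere are identified. The norm `nrm` is only meaningful on `carrier`;
its values outside `carrier` are irrelevant. -/
structure BanachFunctionLattice {Ω : Type*} [MeasurableSpace Ω] (μ : Measure Ω) where
  /-- The set of (classes of) functions that belong to `X`, a complex vector space. -/
  carrier : Submodule ℂ (Ω →ₘ[μ] ℂ)
  /-- The norm of `X`. -/
  nrm : (Ω →ₘ[μ] ℂ) → ℝ
  /-- `X` is a lattice: it contains `|f|` together with `f`. -/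
  abs_mem : ∀ f ∈ carrier,
    AEEqFun.comp (fun z : ℂ => ((‖z‖ : ℝ) : ℂ))
      (Complex.continuous_ofReal.comp continuous_norm) f ∈ carrier
  nrm_eq_zero_iff : ∀ f ∈ carrier, nrm f = 0 ↔ f = 0
  nrm_smul : ∀ (c : ℂ), ∀ f ∈ carrier, nrm (c • f) = ‖c‖ * nrm f
  nrm_add_le : ∀ f ∈ carrier, ∀ g ∈ carrier, nrm (f + g) ≤ nrm f + nrm g
  nrm_mono : ∀ f ∈ carrier, ∀ g ∈ carrier, (∀ᵐ x ∂μ, ‖f x‖ ≤ ‖g x‖) → nrm f ≤ nrm g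
  /-- `X` contains the indicator functions of all sets of finite measure. -/
  indicator_mem : ∀ (B : Set Ω) (hB : MeasurableSet B), μ B < ⊤ →
    AEEqFun.mk (B.indicator fun _ => (1 : ℂ))
      (stronglyMeasurable_const.indicator hB).aestronglyMeasurable ∈ carrier
  /-- `X` is contained in `L₁`. -/
  integrable : ∀ f ∈ carrier, Integrable f μ
  /-- `X` is complete. -/
  complete : ∀ u : ℕ → (Ω →ₘ[μ] ℂ), (∀ i, u i ∈ carrier) →
    (∀ δ : ℝ, 0 < δ → ∃ K : ℕ, ∀ i ≥ K, ∀ j ≥ K, nrm (u i - u j) < δ) →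
    ∃ g ∈ carrier, ∀ δ : ℝ, 0 < δ → ∃ K : ℕ, ∀ i ≥ K, nrm (u i - g) < δ

/-- `X` is rearrangement invariant: two elements `f, g` of `X` with the same distribution function
`y ↦ μ {x : |h x| ≥ y}` have the same norm. -/
def BanachFunctionLattice.RearrangementInvariant {Ω : Type*} [MeasurableSpace Ω] {μ : Measure Ω}
    (X : BanachFunctionLattice μ) : Prop :=
  ∀ f ∈ X.carrier, ∀ g ∈ X.carrier,
    (∀ y : ℝ, μ {x | y ≤ ‖f x‖} = μ {x | y ≤ ‖g x‖}) → X.nrm f = X.nrm g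

/-- Lebesgue measure on `[a, b]`. -/
noncomputable abbrev lebIcc (a b : ℝ) : Measure ℝ := volume.restrict (Icc a b)

/-- The function `x ↦ P x` on `[a, b]` given by a polynomial with complex coefficients. -/
noncomputable def polyFun (a b : ℝ) (P : Polynomial ℂ) : ℝ →ₘ[lebIcc a b] ℂ :=
  AEEqFun.mk (fun x : ℝ => P.eval (x : ℂ))
    (P.continuous.comp Complex.continuous_ofReal).aestronglyMeasurable

/-- The `k`-th of the `N` equal closed subintervals of `[a, b]`, `k = 1, …, N`. -/
def subInterval (a b : ℝ) (N k : ℕ) : Set ℝ :=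
  Icc (a + (b - a) * ((k : ℝ) - 1) / N) (a + (b - a) * (k : ℝ) / N)

/-- The step function `∑ k = 1, …, N, |P (x k)| χ_{Ω k}` on `[a, b]`. -/
noncomputable def sampleFun (a b : ℝ) (N : ℕ) (x : ℕ → ℝ) (P : Polynomial ℂ) :
    ℝ →ₘ[lebIcc a b] ℂ :=
  AEEqFun.mk
    (fun t : ℝ => ∑ k ∈ Finset.Icc 1 N,
      (subInterval a b N k).indicator (fun _ => ((‖P.eval (x k : ℂ)‖ : ℝ) : ℂ)) t)
    (Finset.stronglyMeasurable_fun_sum _ fun _ _ =>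
      stronglyMeasurable_const.indicator measurableSet_Icc).aestronglyMeasurable

/-!
Every essentially bounded function belongs to `X`: it is a uniform limit of simple functions, and
completeness of `X` turns the uniform limit into a limit in `X`.

Lagrange interpolation at the extremal points of the Chebyshev polynomial `T n`, rescaled to the
segment from `x` to `x + h`, writes `h` times the derivative of `P` at `x` as a combination of
values `P (x + t h)`, `0 ≤ t ≤ 1`. Its coefficients have total size `2 n ^ 2`, where `n ^ 2` is the
derivative of `T n` at its right endpoint `1`. With `h = ± (b - a) / 2` on the two halves
of `[a, b]` the translates stay inside `[a, b]`, where rearrangement invariance bounds their norms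
by that of `P`; this is the Markov inequality.

For the Marcinkiewicz–Zygmund inequality let `S` be the step function of samples. Off the partition
points both `|S|` and `2 |P| - |S|` are at most the Taylor majorant `∑ r, hʳ / r! * |P⁽ʳ⁾|`,
`h = (b - a) / N`, whose norm is at most `e ^ q ‖P‖`, `q = 8 n ^ 2 / N`, by the Markov inequality.
Hence `(2 - e ^ q) ‖P‖ ≤ ‖S‖ ≤ e ^ q ‖P‖`, and `q` stays away from `log 2`.
-/

open Filter Topology

theorem exists_simpleFunc_ae_dist_lt {Ω E : Type*} [MeasurableSpace Ω] {μ : Measure Ω}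
    [PseudoMetricSpace E] [MeasurableSpace E] [OpensMeasurableSpace E] [Nonempty E] {f : Ω → E}
    (hf : AEMeasurable f μ) {K : Set E} (hK : TotallyBounded K) (hfK : ∀ᵐ x ∂μ, f x ∈ K)
    {δ : ℝ} (hδ : 0 < δ) : ∃ s : SimpleFunc Ω E, ∀ᵐ x ∂μ, dist (s x) (f x) < δ := by
  obtain ⟨t, ht, hKt⟩ := Metric.totallyBounded_iff.1 hK δ hδ
  obtain ⟨e, he⟩ :=
    (ht.insert (Classical.arbitrary E)).countable.exists_eq_range (insert_nonempty _ _)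
  have hidx : ∀ y ∈ t, ∃ k, e k = y := fun y hy => he.subset (mem_insert_of_mem _ hy)
  choose! idx hidx using hidx
  refine ⟨(SimpleFunc.nearestPt e (ht.toFinset.sup idx)).comp (hf.mk f) hf.measurable_mk, ?_⟩
  filter_upwards [hf.ae_eq_mk, hfK] with x hx hxK
  obtain ⟨y, hy, hxy⟩ := mem_iUnion₂.1 (hKt hxK)
  have hnear :=
    SimpleFunc.edist_nearestPt_le e (f x) (Finset.le_sup (f := idx) (ht.mem_toFinset.2 hy))
  rw [hidx y hy, edist_dist, edist_dist, ENNReal.ofReal_le_ofReal_iff dist_nonneg] at hnear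
  rw [SimpleFunc.coe_comp, Function.comp_apply, ← hx]
  exact hnear.trans_lt (dist_comm (f x) y ▸ hxy)

namespace BanachFunctionLattice

section Basic

variable {Ω : Type*} [MeasurableSpace Ω] {μ : Measure Ω} (X : BanachFunctionLattice μ)
  {f g h : Ω → ℂ}

/-- Membership in `X` for functions rather than their almost everywhere classes, in the way
`MemLp` is membership in `Lp`. -/
def Mem (f : Ω → ℂ) : Prop :=
  ∃ hf : AEStronglyMeasurable f μ, AEEqFun.mk f hf ∈ X.carrier

open Classical in
/-- The norm of `X` for functions rather than their almost everywhere classes. A function that is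
not almost everywhere strongly measurable gets the norm of `0`. -/
noncomputable def normOf (f : Ω → ℂ) : ℝ :=
  X.nrm (if hf : AEStronglyMeasurable f μ then AEEqFun.mk f hf else 0)

variable {X}

theorem normOf_eq_nrm_mk (hf : AEStronglyMeasurable f μ) :
    X.normOf f = X.nrm (AEEqFun.mk f hf) := by
  rw [normOf, dif_pos hf]

theorem mem_coeFn {u : Ω →ₘ[μ] ℂ} (hu : u ∈ X.carrier) : X.Mem u :=
  ⟨u.aestronglyMeasurable, by rwa [AEEqFun.mk_coeFn]⟩

theorem Mem.add (hf : X.Mem f) (hg : X.Mem g) : X.Mem (f + g) :=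
  ⟨hf.1.add hg.1, X.carrier.add_mem hf.2 hg.2⟩

theorem Mem.sub (hf : X.Mem f) (hg : X.Mem g) : X.Mem (f - g) :=
  ⟨hf.1.sub hg.1, X.carrier.sub_mem hf.2 hg.2⟩

theorem Mem.const_smul (hf : X.Mem f) (c : ℂ) : X.Mem (c • f) :=
  ⟨hf.1.const_smul c, X.carrier.smul_mem c hf.2⟩

theorem Mem.ofReal_norm (hf : X.Mem f) : X.Mem fun x => (‖f x‖ : ℂ) :=
  ⟨Complex.continuous_ofReal.comp_aestronglyMeasurable hf.1.norm, X.abs_mem _ hf.2⟩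

theorem Mem.congr (hf : X.Mem f) (hfg : f =ᵐ[μ] g) : X.Mem g :=
  ⟨hf.1.congr hfg, AEEqFun.mk_eq_mk.2 hfg ▸ hf.2⟩

theorem mem_zero : X.Mem 0 :=
  ⟨aestronglyMeasurable_zero, X.carrier.zero_mem⟩

theorem mem_sum {ι : Type*} {s : Finset ι} {F : ι → Ω → ℂ} (hF : ∀ i ∈ s, X.Mem (F i)) :
    X.Mem (∑ i ∈ s, F i) :=
  Finset.sum_induction F X.Mem (fun _ _ => Mem.add) mem_zero hF

theorem mem_indicator_one {B : Set Ω} (hB : MeasurableSet B) (hμB : μ B < ⊤) :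
    X.Mem (B.indicator 1) :=
  ⟨(stronglyMeasurable_one.indicator hB).aestronglyMeasurable, X.indicator_mem B hB hμB⟩

theorem normOf_mono (hf : X.Mem f) (hg : X.Mem g) (hle : ∀ᵐ x ∂μ, ‖f x‖ ≤ ‖g x‖) :
    X.normOf f ≤ X.normOf g := by
  rw [normOf_eq_nrm_mk hf.1, normOf_eq_nrm_mk hg.1]
  refine X.nrm_mono _ hf.2 _ hg.2 ?_
  filter_upwards [hle, AEEqFun.coeFn_mk f hf.1, AEEqFun.coeFn_mk g hg.1] with x hx hfx hgx
  rwa [hfx, hgx]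

theorem normOf_zero : X.normOf 0 = 0 := by
  rw [normOf_eq_nrm_mk aestronglyMeasurable_zero]
  exact (X.nrm_eq_zero_iff 0 X.carrier.zero_mem).2 rfl

theorem normOf_nonneg (hf : X.Mem f) : 0 ≤ X.normOf f :=
  normOf_zero (X := X) ▸ normOf_mono mem_zero hf (.of_forall fun x => by simp)

theorem ae_eq_zero_of_normOf_eq_zero (hf : X.Mem f) (h0 : X.normOf f = 0) : f =ᵐ[μ] 0 := by
  rw [normOf_eq_nrm_mk hf.1, X.nrm_eq_zero_iff _ hf.2] at h0
  exact AEEqFun.mk_eq_mk.1 h0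

theorem normOf_const_smul (hf : X.Mem f) (c : ℂ) : X.normOf (c • f) = ‖c‖ * X.normOf f := by
  rw [normOf_eq_nrm_mk hf.1, normOf_eq_nrm_mk (hf.const_smul c).1]
  exact X.nrm_smul c _ hf.2

theorem normOf_ofReal_norm (hf : X.Mem f) : X.normOf (fun x => (‖f x‖ : ℂ)) = X.normOf f :=
  le_antisymm (normOf_mono hf.ofReal_norm hf (.of_forall fun x => by simp))
    (normOf_mono hf hf.ofReal_norm (.of_forall fun x => by simp))

theorem normOf_add_le (hf : X.Mem f) (hg : X.Mem g) :
    X.normOf (f + g) ≤ X.normOf f + X.normOf g := by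
  rw [normOf_eq_nrm_mk hf.1, normOf_eq_nrm_mk hg.1, normOf_eq_nrm_mk (hf.add hg).1]
  exact X.nrm_add_le _ hf.2 _ hg.2

theorem normOf_sum_le {ι : Type*} {s : Finset ι} {F : ι → Ω → ℂ} (hF : ∀ i ∈ s, X.Mem (F i)) :
    X.normOf (∑ i ∈ s, F i) ≤ ∑ i ∈ s, X.normOf (F i) :=
  Finset.le_sum_of_subadditive_on_pred X.normOf X.Mem normOf_zero.le
    (fun _ _ => normOf_add_le) (fun _ _ => Mem.add) F hF

theorem normOf_le_sum_mul {ι : Type*} {s : Finset ι} {F : ι → Ω → ℂ} {c : ι → ℝ}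
    (hf : X.Mem f) (hF : ∀ i ∈ s, X.Mem (F i)) (hc : ∀ i ∈ s, 0 ≤ c i)
    (hle : ∀ᵐ x ∂μ, ‖f x‖ ≤ ∑ i ∈ s, c i * ‖F i x‖) :
    X.normOf f ≤ ∑ i ∈ s, c i * X.normOf (F i) := by
  have hmem : ∀ i ∈ s, X.Mem ((c i : ℂ) • fun x => (‖F i x‖ : ℂ)) :=
    fun i hi => (hF i hi).ofReal_norm.const_smul _
  calc X.normOf f
      ≤ X.normOf (∑ i ∈ s, (c i : ℂ) • fun x => (‖F i x‖ : ℂ)) := by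
        refine normOf_mono hf (mem_sum hmem) ?_
        filter_upwards [hle] with x hx
        refine hx.trans (le_of_eq_of_le ?_ (RCLike.re_le_norm _))
        simp [Finset.sum_apply]
    _ ≤ ∑ i ∈ s, X.normOf ((c i : ℂ) • fun x => (‖F i x‖ : ℂ)) := normOf_sum_le hmem
    _ = ∑ i ∈ s, c i * X.normOf (F i) := by
        refine Finset.sum_congr rfl fun i hi => ?_
        rw [normOf_const_smul (hF i hi).ofReal_norm, normOf_ofReal_norm (hF i hi),
          Complex.norm_real, Real.norm_of_nonneg (hc i hi)]

theorem normOf_le_add (hf : X.Mem f) (hg : X.Mem g) (hh : X.Mem h)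
    (hle : ∀ᵐ x ∂μ, ‖f x‖ ≤ ‖g x‖ + ‖h x‖) : X.normOf f ≤ X.normOf g + X.normOf h := by
  simpa using normOf_le_sum_mul (s := .univ) (F := ![g, h]) (c := fun _ => 1) hf
    (by simp [Fin.forall_fin_two, hg, hh]) (by simp) (by simpa using hle)

theorem normOf_le_normOf_indicator_add {S T : Set Ω} (hf : X.Mem f) (hS : X.Mem (S.indicator f))
    (hT : X.Mem (T.indicator f)) (hST : ∀ᵐ x ∂μ, x ∈ S ∪ T) :
    X.normOf f ≤ X.normOf (S.indicator f) + X.normOf (T.indicator f) := by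
  refine normOf_le_add hf hS hT ?_
  filter_upwards [hST] with x hx
  rcases hx with hxS | hxT
  · simp [hxS]
  · simp [hxT]

theorem exists_mem_tendsto_normOf_sub {u : ℕ → Ω → ℂ} (hu : ∀ i, X.Mem (u i))
    (hcauchy : Tendsto (fun p : ℕ × ℕ => X.normOf (u p.1 - u p.2)) atTop (𝓝 0)) :
    ∃ g, X.Mem g ∧ Tendsto (fun i => X.normOf (u i - g)) atTop (𝓝 0) := by
  have hsub : ∀ i {g : Ω → ℂ} (hg : X.Mem g),
      X.nrm (AEEqFun.mk (u i) (hu i).1 - AEEqFun.mk g hg.1) = X.normOf (u i - g) :=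
    fun i g hg => (normOf_eq_nrm_mk ((hu i).sub hg).1).symm
  obtain ⟨g, hg, hlim⟩ := X.complete (fun i => AEEqFun.mk (u i) (hu i).1) (fun i => (hu i).2) <| by
    intro δ hδ
    obtain ⟨K, hK⟩ := eventually_atTop.1 (hcauchy.eventually_lt_const hδ)
    refine ⟨max K.1 K.2, fun i hi j hj => ?_⟩
    rw [hsub i (hu j)]
    exact hK (i, j) ⟨le_of_max_le_left hi, le_of_max_le_right hj⟩
  refine ⟨g, mem_coeFn hg, Metric.tendsto_atTop.2 fun δ hδ => ?_⟩
  obtain ⟨K, hK⟩ := hlim δ hδ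
  refine ⟨K, fun i hi => ?_⟩
  rw [Real.dist_0_eq_abs, abs_of_nonneg (normOf_nonneg ((hu i).sub (mem_coeFn hg))),
    ← hsub i (mem_coeFn hg), AEEqFun.mk_coeFn]
  exact hK i hi

theorem RearrangementInvariant.normOf_eq (hX : X.RearrangementInvariant) (hf : X.Mem f)
    (hg : X.Mem g) (hdist : ∀ y : ℝ, 0 < y → μ {x | y ≤ ‖f x‖} = μ {x | y ≤ ‖g x‖}) :
    X.normOf f = X.normOf g := by
  have hmk : ∀ {k : Ω → ℂ} (hk : AEStronglyMeasurable k μ) (y : ℝ),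
      μ {x | y ≤ ‖AEEqFun.mk k hk x‖} = μ {x | y ≤ ‖k x‖} := fun hk y =>
    measure_congr <| (AEEqFun.coeFn_mk _ hk).mono fun x hx => congrArg (y ≤ ‖·‖) hx
  rw [normOf_eq_nrm_mk hf.1, normOf_eq_nrm_mk hg.1]
  refine hX _ hf.2 _ hg.2 fun y => ?_
  rw [hmk, hmk]
  rcases le_or_gt y 0 with hy | hy
  · simp only [hy.trans (norm_nonneg _)]
  · exact hdist y hy

end Basic

section FiniteMeasure

variable {Ω : Type*} [MeasurableSpace Ω] {μ : Measure Ω} [IsFiniteMeasure μ]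
  {X : BanachFunctionLattice μ} {f : Ω → ℂ}

theorem mem_simpleFunc (s : SimpleFunc Ω ℂ) : X.Mem s := by
  induction s using SimpleFunc.induction with
  | @const c B hB =>
    convert! (mem_indicator_one (X := X) hB (measure_lt_top μ B)).const_smul c using 1
    ext x
    by_cases hx : x ∈ B <;> simp [hx]
  | @add f g _ hf hg => exact hf.add hg

theorem mem_one : X.Mem 1 := mem_simpleFunc 1

theorem normOf_le_mul_normOf_one (hf : X.Mem f) {c : ℝ} (hc : 0 ≤ c)
    (hfc : ∀ᵐ x ∂μ, ‖f x‖ ≤ c) : X.normOf f ≤ c * X.normOf 1 := by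
  simpa using normOf_le_sum_mul (s := {()}) (F := fun _ => 1) (c := fun _ => c) hf
    (fun _ _ => mem_one) (by simpa using hc) (by simpa using hfc)

-- Chebyshev's inequality `δ ‖χ_E‖ ≤ ‖v‖` on `E = {δ ≤ |f|}` forces `E` to be null.
theorem ae_eq_zero_of_ae_norm_le_of_tendsto {v : ℕ → Ω → ℂ} (hf : AEStronglyMeasurable f μ)
    (hv : ∀ i, X.Mem (v i)) (hle : ∀ i, ∀ᵐ x ∂μ, ‖f x‖ ≤ ‖v i x‖)
    (hlim : Tendsto (fun i => X.normOf (v i)) atTop (𝓝 0)) : f =ᵐ[μ] 0 := by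
  have hsmall : ∀ δ : ℝ, 0 < δ → ∀ᵐ x ∂μ, ‖f x‖ < δ := by
    intro δ hδ
    let E : Set Ω := {x | δ ≤ ‖hf.mk f x‖}
    have hE : MeasurableSet E :=
      measurableSet_le measurable_const hf.stronglyMeasurable_mk.norm.measurable
    have hmem : X.Mem (E.indicator 1) := mem_indicator_one hE (measure_lt_top μ E)
    have hcheb : ∀ i, δ * X.normOf (E.indicator 1) ≤ X.normOf (v i) := by
      intro i
      rw [← Real.norm_of_nonneg hδ.le, ← Complex.norm_real, ← normOf_const_smul hmem]
      refine normOf_mono (hmem.const_smul _) (hv i) ?_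
      filter_upwards [hle i, hf.ae_eq_mk] with x hx hmk
      by_cases hxE : x ∈ E
      · have hδx : δ ≤ ‖v i x‖ := le_trans (show δ ≤ ‖hf.mk f x‖ from hxE) (hmk ▸ hx)
        simpa [hxE, abs_of_pos hδ] using hδx
      · simp [hxE]
    have hzero : X.normOf (E.indicator 1) = 0 :=
      (nonpos_of_mul_nonpos_right (ge_of_tendsto' hlim hcheb) hδ).antisymm (normOf_nonneg hmem)
    filter_upwards [ae_eq_zero_of_normOf_eq_zero hmem hzero, hf.ae_eq_mk] with x hx hmk
    by_contra! hxδ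
    have hxE : x ∈ E := show δ ≤ ‖hf.mk f x‖ from hmk ▸ hxδ
    simp [hxE] at hx
  filter_upwards [ae_all_iff.2 fun m : ℕ => hsmall (1 / (m + 1)) Nat.one_div_pos_of_nat] with x hx
  exact norm_le_zero_iff.1 <|
    ge_of_tendsto' tendsto_one_div_add_atTop_nhds_zero_nat fun m => (hx m).le

theorem mem_of_ae_norm_sub_le_of_tendsto {u : ℕ → Ω → ℂ} {ε : ℕ → ℝ}
    (hf : AEStronglyMeasurable f μ) (hu : ∀ i, X.Mem (u i)) (hε : ∀ i, 0 ≤ ε i)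
    (hlim : Tendsto ε atTop (𝓝 0)) (huf : ∀ i, ∀ᵐ x ∂μ, ‖u i x - f x‖ ≤ ε i) : X.Mem f := by
  have hcauchy : Tendsto (fun p : ℕ × ℕ => X.normOf (u p.1 - u p.2)) atTop (𝓝 0) := by
    have hbound : Tendsto (fun p : ℕ × ℕ => (ε p.1 + ε p.2) * X.normOf 1) atTop (𝓝 0) := by
      rw [← prod_atTop_atTop_eq]
      simpa using ((hlim.comp tendsto_fst).add (hlim.comp tendsto_snd)).mul_const (X.normOf 1)
    refine squeeze_zero (fun p => normOf_nonneg ((hu p.1).sub (hu p.2))) (fun p => ?_) hbound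
    refine normOf_le_mul_normOf_one ((hu p.1).sub (hu p.2)) (add_nonneg (hε _) (hε _)) ?_
    filter_upwards [huf p.1, huf p.2] with x h₁ h₂
    exact (norm_sub_le_norm_sub_add_norm_sub _ (f x) _).trans
      (add_le_add h₁ (norm_sub_rev (f x) _ ▸ h₂))
  obtain ⟨g, hg, hug⟩ := exists_mem_tendsto_normOf_sub hu hcauchy
  let v : ℕ → Ω → ℂ := fun i => (fun x => (‖(u i - g) x‖ : ℂ)) + (ε i : ℂ) • 1
  have hv : ∀ i, X.Mem (v i) := fun i => ((hu i).sub hg).ofReal_norm.add (mem_one.const_smul _)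
  have hv_lim : Tendsto (fun i => X.normOf (v i)) atTop (𝓝 0) := by
    refine squeeze_zero (fun i => normOf_nonneg (hv i)) (fun i => ?_)
      (by simpa using hug.add (hlim.mul_const (X.normOf 1)))
    refine (normOf_add_le ((hu i).sub hg).ofReal_norm (mem_one.const_smul _)).trans_eq ?_
    rw [normOf_ofReal_norm ((hu i).sub hg), normOf_const_smul mem_one, Complex.norm_real,
      Real.norm_of_nonneg (hε i)]
  have hgf : g - f =ᵐ[μ] 0 := by
    refine ae_eq_zero_of_ae_norm_le_of_tendsto (hg.1.sub hf) hv (fun i => ?_) hv_lim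
    filter_upwards [huf i] with x hx
    calc ‖g x - f x‖ ≤ ‖u i x - g x‖ + ε i :=
          (norm_sub_le_norm_sub_add_norm_sub _ (u i x) _).trans
            (add_le_add (norm_sub_rev (g x) _).le hx)
      _ ≤ ‖v i x‖ := le_of_eq_of_le (by simp [v]) (RCLike.re_le_norm _)
  exact hg.congr (hgf.mono fun x hx => sub_eq_zero.1 hx)

theorem mem_of_memLp_top (hf : MemLp f ⊤ μ) : X.Mem f := by
  choose s hs using fun i : ℕ => exists_simpleFunc_ae_dist_lt hf.1.aemeasurable
    (isCompact_closedBall (0 : ℂ) (lpNorm f ⊤ μ)).totallyBounded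
    ((ae_le_lpNorm_exponent_top hf).mono fun x hx => mem_closedBall_zero_iff.2 hx)
    (Nat.one_div_pos_of_nat (α := ℝ) (n := i))
  exact mem_of_ae_norm_sub_le_of_tendsto hf.1 (fun i => mem_simpleFunc (s i))
    (fun i => Nat.one_div_pos_of_nat.le) tendsto_one_div_add_atTop_nhds_zero_nat
    fun i => (hs i).mono fun x hx => dist_eq_norm (s i x) (f x) ▸ hx.le

theorem RearrangementInvariant.normOf_indicator_comp (hX : X.RearrangementInvariant)
    {S T : Set Ω} (hS : MeasurableSet S) (hT : MeasurableSet T) {φ : Ω → Ω}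
    (hφ : MeasurePreserving φ (μ.restrict S) (μ.restrict T)) (hf : MemLp f ⊤ μ) :
    X.normOf (S.indicator (f ∘ φ)) = X.normOf (T.indicator f) := by
  have hcomp : MemLp (S.indicator (f ∘ φ)) ⊤ μ :=
    (memLp_indicator_iff_restrict hS).2 ((hf.restrict T).comp_measurePreserving hφ)
  refine hX.normOf_eq (mem_of_memLp_top hcomp) (mem_of_memLp_top (hf.indicator hT)) fun y hy => ?_
  have hlevel : ∀ {B : Set Ω}, MeasurableSet B → ∀ k : Ω → ℂ,
      μ {x | y ≤ ‖B.indicator k x‖} = μ.restrict B {x | y ≤ ‖k x‖} := by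
    intro B hB k
    rw [Measure.restrict_apply' hB]
    congr 1
    ext x
    by_cases hx : x ∈ B <;> simp [hx, hy]
  rw [hlevel hS, hlevel hT, ← hφ.measure_preimage
    (nullMeasurableSet_le aemeasurable_const (hf.restrict T).1.norm.aemeasurable)]
  rfl

end FiniteMeasure

theorem RearrangementInvariant.normOf_indicator_add_right_le {G : Type*} [AddGroup G]
    [MeasurableSpace G] [MeasurableAdd G] {ν : Measure G} [ν.IsAddRightInvariant] {K S : Set G}
    [IsFiniteMeasure (ν.restrict K)] {X : BanachFunctionLattice (ν.restrict K)}
    (hX : X.RearrangementInvariant) (hS : MeasurableSet S) (hSK : S ⊆ K) {g : G}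
    (hSg : ∀ x ∈ S, x + g ∈ K) {f : G → ℂ} (hf : MemLp f ⊤ (ν.restrict K)) :
    X.normOf (S.indicator fun x => f (x + g)) ≤ X.normOf f := by
  let T : Set G := (· + -g) ⁻¹' S
  have hT : MeasurableSet T := measurable_add_const (-g) hS
  have hTK : T ⊆ K := fun x hx => by simpa using hSg (x + -g) hx
  have hpre : (· + g) ⁻¹' T = S := by simp [T, preimage_preimage]
  have hφ : MeasurePreserving (· + g) ((ν.restrict K).restrict S) ((ν.restrict K).restrict T) := by
    rw [Measure.restrict_restrict_of_subset hSK, Measure.restrict_restrict_of_subset hTK, ← hpre]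
    exact (measurePreserving_add_right ν g).restrict_preimage hT
  calc X.normOf (S.indicator fun x => f (x + g)) = X.normOf (T.indicator f) :=
        hX.normOf_indicator_comp hS hT hφ hf
    _ ≤ X.normOf f := normOf_mono (mem_of_memLp_top (hf.indicator hT)) (mem_of_memLp_top hf)
        (.of_forall fun x => norm_indicator_le_norm_self f x)

end BanachFunctionLattice

section ChebyshevNodes

open Polynomial Polynomial.Chebyshev

/-- The coefficients of Lagrange interpolation at the extremal points `node n i`, `i ≤ n`, of the
Chebyshev polynomial `T n` for the functional `P ↦ P⁽ᵏ⁾ x` on polynomials of degree at most `n`. -/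
noncomputable def nodeWeight (n k : ℕ) (x : ℝ) (i : ℕ) : ℝ :=
  k.factorial * ((∏ j ∈ (Finset.range (n + 1)).erase i, (node n i - node n j))⁻¹ *
    ∑ t ∈ ((Finset.range (n + 1)).erase i).powersetCard (n - k), ∏ j ∈ t, (x - node n j))

theorem eval_iterate_derivative_eq_sum_nodeWeight {F : Type*} [Field F] [Algebra ℝ F] {n k : ℕ}
    (hk : k ≤ n) {P : F[X]} (hP : P.natDegree ≤ n) (x : ℝ) :
    (derivative^[k] P).eval (algebraMap ℝ F x) =
      ∑ i ∈ Finset.range (n + 1),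
        algebraMap ℝ F (nodeWeight n k x i) * P.eval (algebraMap ℝ F (node n i)) := by
  have hinj : InjOn (fun i => algebraMap ℝ F (node n i)) (Finset.range (n + 1)) :=
    (algebraMap ℝ F).injective.comp_injOn (strictAntiOn_node n).injOn
  have hdeg : P.degree < (Finset.range (n + 1)).card := by
    rw [Finset.card_range]
    exact degree_le_natDegree.trans_lt (Nat.cast_lt.2 (Nat.lt_succ_of_le hP))
  rw [Lagrange.eval_iterate_derivative_eq_sum hinj hdeg (by simpa using Nat.lt_succ_of_le hk),
    Finset.mul_sum]
  refine Finset.sum_congr rfl fun i _ => ?_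
  simp only [nodeWeight, Finset.card_range, map_mul, map_inv₀, map_natCast, map_prod, map_sum,
    map_sub, Nat.add_sub_add_right]
  ring

theorem neg_one_pow_mul_nodeWeight_nonneg {n i : ℕ} (hi : i ≤ n) (k : ℕ) {x : ℝ} (hx : 1 ≤ x) :
    0 ≤ (-1) ^ i * nodeWeight n k x i := by
  have hprod : 0 < (-1) ^ i * (∏ j ∈ (Finset.range (n + 1)).erase i, (node n i - node n j))⁻¹ := by
    simpa [mul_inv, ← inv_pow, mul_comm] using inv_pos_of_pos (zero_lt_prod_node_sub_node hi)
  have hsum : 0 ≤ ∑ t ∈ ((Finset.range (n + 1)).erase i).powersetCard (n - k),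
      ∏ j ∈ t, (x - node n j) :=
    Finset.sum_nonneg fun t _ => Finset.prod_nonneg fun j _ =>
      sub_nonneg.2 (node_mem_Icc.2.trans hx)
  rw [nodeWeight, mul_left_comm, ← mul_assoc ((-1) ^ i)]
  positivity

-- The weights alternate in sign exactly as `T n` does at its extremal points.
theorem sum_abs_nodeWeight {n k : ℕ} (hk : k ≤ n) {x : ℝ} (hx : 1 ≤ x) :
    ∑ i ∈ Finset.range (n + 1), |nodeWeight n k x i| = (derivative^[k] (T ℝ n)).eval x := by
  have hT : (T ℝ n).natDegree ≤ n := by simp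
  refine .trans (Finset.sum_congr rfl fun i hi => ?_)
    (eval_iterate_derivative_eq_sum_nodeWeight hk hT x).symm
  have hin : i ≤ n := Finset.mem_range_succ_iff.1 hi
  rw [Algebra.algebraMap_self_apply, Algebra.algebraMap_self_apply,
    eval_T_real_node (Finset.mem_Iic.2 hin), mul_comm,
    ← abs_of_nonneg (neg_one_pow_mul_nodeWeight_nonneg hin k hx), abs_mul, abs_neg_one_pow, one_mul]

theorem sum_abs_nodeWeight_one_one {n : ℕ} (hn : 1 ≤ n) :
    ∑ i ∈ Finset.range (n + 1), |nodeWeight n 1 1 i| = (n : ℝ) ^ 2 := by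
  rw [sum_abs_nodeWeight hn le_rfl, Function.iterate_one, T_derivative_eq_U]
  simp [U_eval_one, sq]

theorem exists_mul_eval_derivative_eq_sum (n : ℕ) :
    ∃ t c : ℕ → ℝ, (∀ i, t i ∈ Icc (0 : ℝ) 1) ∧
      ∑ i ∈ Finset.range (n + 1), |c i| ≤ 2 * (n : ℝ) ^ 2 ∧
      ∀ P : ℂ[X], P.natDegree ≤ n → ∀ x h : ℂ,
        h * P.derivative.eval x = ∑ i ∈ Finset.range (n + 1), (c i : ℂ) * P.eval (x + t i * h) := by
  rcases n.eq_zero_or_pos with rfl | hn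
  · refine ⟨0, 0, by simp, by simp, fun P hP x h => ?_⟩
    rw [eq_C_of_natDegree_le_zero hP]
    simp
  refine ⟨fun i => (1 - node n i) / 2, fun i => -2 * nodeWeight n 1 1 i, fun i => ?_, ?_,
    fun P hP x h => ?_⟩
  · have hnode := node_mem_Icc (n := n) (i := i)
    constructor <;> linarith [hnode.1, hnode.2]
  · simp_rw [abs_mul, abs_neg, abs_two, ← Finset.mul_sum, sum_abs_nodeWeight_one_one hn, le_refl]
  -- The affine map below sends `1` to `x` and `-1` to `x + h`.
  let L : ℂ[X] := C (x + h / 2) - C (h / 2) * X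
  have hL : L.natDegree ≤ 1 := by unfold L; compute_degree
  have hPL : (P.comp L).natDegree ≤ n :=
    natDegree_comp_le.trans ((Nat.mul_le_mul hP hL).trans_eq (mul_one n))
  have hlagrange := eval_iterate_derivative_eq_sum_nodeWeight hn hPL 1
  have hL1 : x + h / 2 - h / 2 = x := by ring
  have hderiv : (P.comp L).derivative.eval 1 = -(h / 2) * P.derivative.eval x := by
    simp [L, derivative_comp, hL1]
  rw [map_one, Function.iterate_one, hderiv] at hlagrange
  calc h * P.derivative.eval x = -2 * (-(h / 2) * P.derivative.eval x) := by ring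
    _ = _ := by
      rw [hlagrange, Finset.mul_sum]
      refine Finset.sum_congr rfl fun i _ => ?_
      have hLi : L.eval (node n i : ℂ) = x + (1 - node n i) / 2 * h := by
        simp only [L, eval_sub, eval_C, eval_mul, eval_X]
        ring
      rw [eval_comp, Complex.coe_algebraMap, hLi]
      push_cast
      ring

end ChebyshevNodes

section Markov

open BanachFunctionLattice Polynomial

theorem memLp_top_restrict_of_isCompact {α E : Type*} [TopologicalSpace α] [MeasurableSpace α]
    [OpensMeasurableSpace α] [NormedAddCommGroup E] [SecondCountableTopologyEither α E]
    {ν : Measure α} {K : Set α} (hK : IsCompact K) (hKm : MeasurableSet K) {f : α → E}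
    (hf : ContinuousOn f K) : MemLp f ⊤ (ν.restrict K) := by
  obtain ⟨C, hC⟩ := hK.exists_bound_of_continuousOn hf
  exact memLp_top_of_bound (hf.aestronglyMeasurable hKm) C (ae_restrict_of_forall_mem hKm hC)

/-- A polynomial with complex coefficients as a function of a real variable. Its class modulo
almost everywhere equality on `[a, b]` is `polyFun a b P`. -/
noncomputable def realEval (P : ℂ[X]) (x : ℝ) : ℂ := P.eval (x : ℂ)

theorem continuous_realEval (P : ℂ[X]) : Continuous (realEval P) :=
  P.continuous.comp Complex.continuous_ofReal

theorem memLp_top_realEval (a b : ℝ) (P : ℂ[X]) : MemLp (realEval P) ⊤ (lebIcc a b) :=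
  memLp_top_restrict_of_isCompact isCompact_Icc measurableSet_Icc
    (continuous_realEval P).continuousOn

variable {a b : ℝ} {X : BanachFunctionLattice (lebIcc a b)}

theorem mem_indicator_of_continuous {S : Set ℝ} (hS : MeasurableSet S) {f : ℝ → ℂ}
    (hf : Continuous f) : X.Mem (S.indicator f) :=
  mem_of_memLp_top <| .indicator hS <|
    memLp_top_restrict_of_isCompact isCompact_Icc measurableSet_Icc hf.continuousOn

theorem mem_of_continuous {f : ℝ → ℂ} (hf : Continuous f) : X.Mem f := by
  simpa using mem_indicator_of_continuous .univ hf

theorem mem_realEval (P : ℂ[X]) : X.Mem (realEval P) :=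
  mem_of_continuous (continuous_realEval P)

theorem nrm_polyFun (P : ℂ[X]) : X.nrm (polyFun a b P) = X.normOf (realEval P) :=
  (normOf_eq_nrm_mk (mem_realEval (X := X) P).1).symm

theorem abs_mul_normOf_indicator_derivative_le (hX : X.RearrangementInvariant) {n : ℕ} {P : ℂ[X]}
    (hP : P.natDegree ≤ n) {S : Set ℝ} (hS : MeasurableSet S) (hSab : S ⊆ Icc a b) {h : ℝ}
    (hSh : ∀ x ∈ S, x + h ∈ Icc a b) :
    |h| * X.normOf (S.indicator (realEval (derivative P))) ≤
      2 * (n : ℝ) ^ 2 * X.normOf (realEval P) := by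
  obtain ⟨t, c, ht, hc, hsum⟩ := exists_mul_eval_derivative_eq_sum n
  let shift (i : ℕ) : ℝ → ℂ := S.indicator fun x => realEval P (x + t i * h)
  have hshift_mem : ∀ i, X.Mem (shift i) := fun i =>
    mem_indicator_of_continuous hS ((continuous_realEval P).comp (continuous_add_const _))
  have hshift_le : ∀ i, X.normOf (shift i) ≤ X.normOf (realEval P) := fun i =>
    hX.normOf_indicator_add_right_le hS hSab
      (fun x hx => (convex_Icc a b).add_smul_mem (hSab hx) (hSh x hx) (ht i))
      (memLp_top_realEval a b P)
  have hpointwise : ∀ x, ‖((h : ℂ) • S.indicator (realEval (derivative P))) x‖ ≤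
      ∑ i ∈ Finset.range (n + 1), |c i| * ‖shift i x‖ := by
    intro x
    by_cases hx : x ∈ S
    · have hsum' : (h : ℂ) * realEval (derivative P) x =
          ∑ i ∈ Finset.range (n + 1), (c i : ℂ) * realEval P (x + t i * h) := by
        simpa [realEval] using hsum P hP x h
      simp only [shift, Pi.smul_apply, indicator_of_mem hx, smul_eq_mul, hsum']
      exact (norm_sum_le _ _).trans_eq (by simp)
    · simp [shift, hx]
  have hD : X.Mem (S.indicator (realEval (derivative P))) :=
    mem_indicator_of_continuous hS (continuous_realEval _)
  calc |h| * X.normOf (S.indicator (realEval (derivative P)))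
      = X.normOf ((h : ℂ) • S.indicator (realEval (derivative P))) := by
        rw [normOf_const_smul hD, Complex.norm_real, Real.norm_eq_abs]
    _ ≤ ∑ i ∈ Finset.range (n + 1), |c i| * X.normOf (shift i) :=
        normOf_le_sum_mul (hD.const_smul _) (fun i _ => hshift_mem i)
          (fun i _ => abs_nonneg _) (.of_forall hpointwise)
    _ ≤ ∑ i ∈ Finset.range (n + 1), |c i| * X.normOf (realEval P) := by
        gcongr with i
        exact hshift_le i
    _ ≤ 2 * (n : ℝ) ^ 2 * X.normOf (realEval P) := by
        rw [← Finset.sum_mul]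
        exact mul_le_mul_of_nonneg_right hc (normOf_nonneg (mem_realEval P))

theorem normOf_derivative_le (hab : a < b) (hX : X.RearrangementInvariant) {n : ℕ} {P : ℂ[X]}
    (hP : P.natDegree ≤ n) :
    X.normOf (realEval (derivative P)) ≤ 8 * (n : ℝ) ^ 2 / (b - a) * X.normOf (realEval P) := by
  have hba : 0 < b - a := sub_pos.2 hab
  let m := (a + b) / 2
  have hleft : (b - a) / 2 * X.normOf ((Icc a m).indicator (realEval (derivative P))) ≤
      2 * (n : ℝ) ^ 2 * X.normOf (realEval P) := by
    rw [← abs_of_pos (half_pos hba)]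
    exact abs_mul_normOf_indicator_derivative_le hX hP measurableSet_Icc
      (Icc_subset_Icc_right (by grind)) (by grind)
  have hright : (b - a) / 2 * X.normOf ((Icc m b).indicator (realEval (derivative P))) ≤
      2 * (n : ℝ) ^ 2 * X.normOf (realEval P) := by
    rw [← abs_of_pos (half_pos hba), ← abs_neg]
    exact abs_mul_normOf_indicator_derivative_le hX hP measurableSet_Icc
      (Icc_subset_Icc_left (by grind)) (by grind)
  have hsplit := normOf_le_normOf_indicator_add (mem_realEval (X := X) (derivative P))
    (mem_indicator_of_continuous (measurableSet_Icc (a := a) (b := m)) (continuous_realEval _))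
    (mem_indicator_of_continuous (measurableSet_Icc (a := m) (b := b)) (continuous_realEval _))
    (ae_restrict_of_forall_mem measurableSet_Icc fun x hx =>
      Icc_subset_Icc_union_Icc hx)
  rw [div_mul_eq_mul_div, le_div_iff₀ hba]
  nlinarith

theorem normOf_iterate_derivative_le (hab : a < b) (hX : X.RearrangementInvariant) {n : ℕ} (r : ℕ)
    {P : ℂ[X]} (hP : P.natDegree ≤ n) :
    X.normOf (realEval (derivative^[r] P)) ≤
      (8 * (n : ℝ) ^ 2 / (b - a)) ^ r * X.normOf (realEval P) := by
  induction r with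
  | zero => simp
  | succ r ih =>
    have hdeg : (derivative^[r] P).natDegree ≤ n :=
      (P.natDegree_iterate_derivative r).trans ((Nat.sub_le _ _).trans hP)
    rw [Function.iterate_succ_apply', pow_succ', mul_assoc]
    exact (normOf_derivative_le hab hX hdeg).trans <| mul_le_mul_of_nonneg_left ih <|
      div_nonneg (by positivity) (sub_nonneg.2 hab.le)

end Markov

section MarcinkiewiczZygmund

open BanachFunctionLattice Polynomial

/-- The majorant `∑ r, hʳ / r! * |P⁽ʳ⁾ z|` that Taylor's formula at `z` gives for `|P|` on the disc
of radius `h` about `z`. -/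
noncomputable def taylorMajorant {𝕜 : Type*} [RCLike 𝕜] (P : 𝕜[X]) (h : ℝ) (z : 𝕜) : ℝ :=
  ∑ r ∈ Finset.range (P.natDegree + 1), h ^ r / r.factorial * ‖(derivative^[r] P).eval z‖

theorem norm_eval_sub_add_norm_eval_le_taylorMajorant {𝕜 : Type*} [RCLike 𝕜] (P : 𝕜[X])
    {w z : 𝕜} {h : ℝ} (hwz : ‖w - z‖ ≤ h) :
    ‖P.eval w - P.eval z‖ + ‖P.eval z‖ ≤ taylorMajorant P h z := by
  have htaylor : P.eval w =
      ∑ r ∈ Finset.range (P.natDegree + 1), (hasseDeriv r P).eval z * (w - z) ^ r := by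
    rw [← taylor_eval_sub z, eval_eq_sum_range, natDegree_taylor]
    simp_rw [taylor_coeff]
  have hderiv : ∀ r, ‖(derivative^[r] P).eval z‖ = r.factorial * ‖(hasseDeriv r P).eval z‖ := by
    intro r
    simp [← factorial_smul_hasseDeriv]
  rw [htaylor, taylorMajorant, Finset.sum_range_succ', Finset.sum_range_succ']
  simp only [hasseDeriv_zero', pow_zero, mul_one, add_sub_cancel_right, Nat.factorial_zero,
    Nat.cast_one, div_one, one_mul, Function.iterate_zero_apply, add_le_add_iff_right]
  refine (norm_sum_le _ _).trans (Finset.sum_le_sum fun r _ => ?_)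
  rw [hderiv, norm_mul, norm_pow]
  calc ‖(hasseDeriv (r + 1) P).eval z‖ * ‖w - z‖ ^ (r + 1)
      ≤ ‖(hasseDeriv (r + 1) P).eval z‖ * h ^ (r + 1) := by gcongr
    _ = h ^ (r + 1) / (r + 1).factorial *
          ((r + 1).factorial * ‖(hasseDeriv (r + 1) P).eval z‖) := by field_simp

theorem mem_subInterval_iff {a b : ℝ} (hab : a < b) {N : ℕ} (hN : 0 < N) {k : ℕ} {t : ℝ} :
    t ∈ subInterval a b N k ↔ (t - a) * N / (b - a) ∈ Icc (k - 1 : ℝ) k := by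
  have hba : 0 < b - a := sub_pos.2 hab
  have hN' : (0 : ℝ) < N := Nat.cast_pos.2 hN
  rw [subInterval, mem_Icc, mem_Icc, le_div_iff₀ hba, div_le_iff₀ hba, ← le_sub_iff_add_le',
    ← sub_le_iff_le_add', div_le_iff₀ hN', le_div_iff₀ hN', mul_comm (b - a), mul_comm (b - a)]

theorem norm_sub_le_of_mem_subInterval {a b : ℝ} {N k : ℕ} {s t : ℝ}
    (hs : s ∈ subInterval a b N k) (ht : t ∈ subInterval a b N k) :
    ‖(s : ℂ) - t‖ ≤ (b - a) / N := by
  rw [← Complex.ofReal_sub, Complex.norm_real, Real.norm_eq_abs]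
  exact (abs_sub_le_of_le_of_le hs.1 hs.2 ht.1 ht.2).trans_eq (by ring)

theorem ae_exists_forall_mem_subInterval_iff {a b : ℝ} (hab : a < b) {N : ℕ} (hN : 0 < N) :
    ∀ᵐ t ∂(lebIcc a b), ∃ k ∈ Finset.Icc 1 N, ∀ j ∈ Finset.Icc 1 N,
      t ∈ subInterval a b N j ↔ j = k := by
  have hba : 0 < b - a := sub_pos.2 hab
  have hN' : (0 : ℝ) < N := Nat.cast_pos.2 hN
  have hcount : ∀ᵐ t ∂(lebIcc a b), t ∉ range fun k : ℕ => a + k * (b - a) / N :=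
    (countable_range _).ae_notMem _
  filter_upwards [hcount, ae_restrict_mem measurableSet_Icc] with t ht htab
  set τ := (t - a) * N / (b - a) with hτ
  have hτ_ne : ∀ k : ℕ, τ ≠ k := fun k hk => ht ⟨k, by simp only [← hk, hτ]; field_simp; ring⟩
  have hτ_pos : 0 < τ := lt_of_le_of_ne
    (div_nonneg (mul_nonneg (sub_nonneg.2 htab.1) hN'.le) hba.le) (mod_cast (hτ_ne 0).symm)
  have hτ_le : τ ≤ N := by
    rw [hτ, div_le_iff₀ hba, mul_comm]
    gcongr
    exact htab.2
  refine ⟨⌈τ⌉₊, Finset.mem_Icc.2 ⟨Nat.ceil_pos.2 hτ_pos, Nat.ceil_le.2 hτ_le⟩, fun j hj => ?_⟩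
  have hj1 := (Finset.mem_Icc.1 hj).1
  rw [mem_subInterval_iff hab hN, eq_comm, Nat.ceil_eq_iff (by omega), mem_Icc, Nat.cast_pred hj1]
  refine and_congr_left' ⟨fun h => lt_of_le_of_ne h ?_, le_of_lt⟩
  exact_mod_cast (Nat.cast_pred (R := ℝ) hj1 ▸ hτ_ne (j - 1)).symm

/-- The step function with the value `|P (x k)|` on the `k`-th subinterval. Its class modulo almost
everywhere equality on `[a, b]` is `sampleFun a b N x P`. -/
noncomputable def sampleStep (a b : ℝ) (N : ℕ) (x : ℕ → ℝ) (P : ℂ[X]) (t : ℝ) : ℂ :=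
  ∑ k ∈ Finset.Icc 1 N,
    (subInterval a b N k).indicator (fun _ => ((‖P.eval (x k : ℂ)‖ : ℝ) : ℂ)) t

theorem ae_exists_norm_sampleStep_eq {a b : ℝ} (hab : a < b) {N : ℕ} (hN : 0 < N) {x : ℕ → ℝ}
    (hx : ∀ k ∈ Finset.Icc 1 N, x k ∈ subInterval a b N k) (P : ℂ[X]) :
    ∀ᵐ t : ℝ ∂(lebIcc a b), ∃ w : ℂ, ‖w - t‖ ≤ (b - a) / N ∧
      ‖sampleStep a b N x P t‖ = ‖P.eval w‖ := by
  filter_upwards [ae_exists_forall_mem_subInterval_iff hab hN] with t ⟨k, hk, htk⟩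
  refine ⟨x k, norm_sub_le_of_mem_subInterval (hx k hk) ((htk k hk).2 rfl), ?_⟩
  rw [sampleStep, Finset.sum_eq_single_of_mem k hk fun j hj hjk =>
    indicator_of_notMem (mt (htk j hj).1 hjk) _, indicator_of_mem ((htk k hk).2 rfl),
    Complex.norm_real, norm_norm]

variable {a b : ℝ} {X : BanachFunctionLattice (lebIcc a b)}

theorem mem_sampleStep (N : ℕ) (x : ℕ → ℝ) (P : ℂ[X]) : X.Mem (sampleStep a b N x P) :=
  mem_of_memLp_top <| memLp_finsetSum _ fun _ _ => (memLp_const _).indicator measurableSet_Icc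

theorem nrm_sampleFun (N : ℕ) (x : ℕ → ℝ) (P : ℂ[X]) :
    X.nrm (sampleFun a b N x P) = X.normOf (sampleStep a b N x P) :=
  (normOf_eq_nrm_mk (mem_sampleStep (X := X) N x P).1).symm

theorem mem_taylorMajorant (P : ℂ[X]) (h : ℝ) :
    X.Mem fun t => (taylorMajorant P h (t : ℂ) : ℂ) := by
  refine mem_of_continuous (Complex.continuous_ofReal.comp ?_)
  exact continuous_finsetSum _ fun r _ => continuous_const.mul (continuous_realEval _).norm

theorem normOf_taylorMajorant_le (hab : a < b) (hX : X.RearrangementInvariant) {n : ℕ} {P : ℂ[X]}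
    (hP : P.natDegree ≤ n) {h : ℝ} (hh : 0 ≤ h) :
    X.normOf (fun t => (taylorMajorant P h (t : ℂ) : ℂ)) ≤
      Real.exp (h * (8 * (n : ℝ) ^ 2 / (b - a))) * X.normOf (realEval P) := by
  set M := 8 * (n : ℝ) ^ 2 / (b - a)
  have hM : 0 ≤ M := div_nonneg (by positivity) (sub_nonneg.2 hab.le)
  calc X.normOf (fun t => (taylorMajorant P h (t : ℂ) : ℂ))
      ≤ ∑ r ∈ Finset.range (P.natDegree + 1),
          h ^ r / r.factorial * X.normOf (realEval (derivative^[r] P)) := by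
        refine normOf_le_sum_mul (mem_taylorMajorant P h) (fun r _ => mem_realEval _)
          (fun r _ => by positivity) (.of_forall fun t => ?_)
        rw [Complex.norm_real, taylorMajorant,
          Real.norm_of_nonneg (Finset.sum_nonneg fun r _ => by positivity)]
        rfl
    _ ≤ ∑ r ∈ Finset.range (P.natDegree + 1),
          h ^ r / r.factorial * (M ^ r * X.normOf (realEval P)) := by
        gcongr with r
        exact normOf_iterate_derivative_le hab hX r hP
    _ = (∑ r ∈ Finset.range (P.natDegree + 1), (h * M) ^ r / r.factorial) *
          X.normOf (realEval P) := by
        rw [Finset.sum_mul]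
        exact Finset.sum_congr rfl fun r _ => by ring
    _ ≤ Real.exp (h * M) * X.normOf (realEval P) :=
        mul_le_mul_of_nonneg_right (Real.sum_le_exp_of_nonneg (mul_nonneg hh hM) _)
          (normOf_nonneg (mem_realEval P))

theorem normOf_taylorMajorant_div_le (hab : a < b) (hX : X.RearrangementInvariant) {n : ℕ}
    {P : ℂ[X]} (hP : P.natDegree ≤ n) (N : ℕ) :
    X.normOf (fun t => (taylorMajorant P ((b - a) / N) (t : ℂ) : ℂ)) ≤
      Real.exp (8 * (n : ℝ) ^ 2 / N) * X.normOf (realEval P) := by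
  have hba : 0 < b - a := sub_pos.2 hab
  refine (normOf_taylorMajorant_le hab hX hP (by positivity)).trans_eq ?_
  congr 2
  field_simp

theorem normOf_sampleStep_le (hab : a < b) (hX : X.RearrangementInvariant) {n N : ℕ} (hN : 0 < N)
    {x : ℕ → ℝ} (hx : ∀ k ∈ Finset.Icc 1 N, x k ∈ subInterval a b N k) {P : ℂ[X]}
    (hP : P.natDegree ≤ n) :
    X.normOf (sampleStep a b N x P) ≤
      Real.exp (8 * (n : ℝ) ^ 2 / N) * X.normOf (realEval P) := by
  refine le_trans (normOf_mono (mem_sampleStep N x P) (mem_taylorMajorant P ((b - a) / N)) ?_)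
    (normOf_taylorMajorant_div_le hab hX hP N)
  filter_upwards [ae_exists_norm_sampleStep_eq hab hN hx P] with t ⟨w, hwt, hw⟩
  rw [hw, Complex.norm_real]
  calc ‖P.eval w‖ ≤ ‖P.eval w - P.eval (t : ℂ)‖ + ‖P.eval (t : ℂ)‖ := norm_le_norm_sub_add _ _
    _ ≤ taylorMajorant P ((b - a) / N) (t : ℂ) :=
        norm_eval_sub_add_norm_eval_le_taylorMajorant P hwt
    _ ≤ ‖taylorMajorant P ((b - a) / N) (t : ℂ)‖ := Real.le_norm_self _

theorem two_sub_exp_mul_normOf_le_normOf_sampleStep (hab : a < b) (hX : X.RearrangementInvariant)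
    {n N : ℕ} (hN : 0 < N) {x : ℕ → ℝ} (hx : ∀ k ∈ Finset.Icc 1 N, x k ∈ subInterval a b N k)
    {P : ℂ[X]} (hP : P.natDegree ≤ n) :
    (2 - Real.exp (8 * (n : ℝ) ^ 2 / N)) * X.normOf (realEval P) ≤
      X.normOf (sampleStep a b N x P) := by
  have htwo : 2 * X.normOf (realEval P) ≤ X.normOf (sampleStep a b N x P) +
      X.normOf (fun t => (taylorMajorant P ((b - a) / N) (t : ℂ) : ℂ)) := by
    rw [← Complex.norm_two, ← normOf_const_smul (mem_realEval P)]
    refine normOf_le_add ((mem_realEval P).const_smul 2) (mem_sampleStep N x P)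
      (mem_taylorMajorant P _) ?_
    filter_upwards [ae_exists_norm_sampleStep_eq hab hN hx P] with t ⟨w, hwt, hw⟩
    rw [hw, Complex.norm_real, Pi.smul_apply, norm_smul, Complex.norm_two, realEval]
    linarith [norm_eval_sub_add_norm_eval_le_taylorMajorant P hwt,
      norm_le_norm_add_norm_sub (P.eval w) (P.eval (t : ℂ)),
      Real.le_norm_self (taylorMajorant P ((b - a) / N) (t : ℂ))]
  linarith [normOf_taylorMajorant_div_le hab hX hP N]

theorem exists_forall_exp_le_and_one_le_mul_two_sub_exp {ε : ℝ} (hε : 0 < ε) :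
    ∃ C > 0, ∀ s N : ℝ, 0 < N → (8 / Real.log 2 + ε) * s ≤ N →
      Real.exp (8 * s / N) ≤ C ∧ 1 ≤ C * (2 - Real.exp (8 * s / N)) := by
  have hlog : 0 < Real.log 2 := Real.log_pos one_lt_two
  set K := 8 / Real.log 2 + ε with hK
  have hKpos : 0 < K := by positivity
  have hlt : 8 / K < Real.log 2 := by
    rw [div_lt_iff₀ hKpos, hK, mul_add, mul_div_cancel₀ _ hlog.ne']
    exact lt_add_of_pos_right _ (mul_pos hlog hε)
  have hexp : Real.exp (8 / K) < 2 := (Real.lt_log_iff_exp_lt two_pos).1 hlt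
  have hgap : 0 < 2 - Real.exp (8 / K) := sub_pos.2 hexp
  refine ⟨2 + (2 - Real.exp (8 / K))⁻¹, by positivity, fun s N hN hsN => ?_⟩
  have hle : Real.exp (8 * s / N) ≤ Real.exp (8 / K) := by
    rw [Real.exp_le_exp, div_le_div_iff₀ hN hKpos]
    linarith
  have hinv : 0 < (2 - Real.exp (8 / K))⁻¹ := inv_pos.2 hgap
  constructor
  · linarith
  · calc (1 : ℝ) = (2 - Real.exp (8 / K))⁻¹ * (2 - Real.exp (8 / K)) :=
          (inv_mul_cancel₀ hgap.ne').symm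
      _ ≤ (2 + (2 - Real.exp (8 / K))⁻¹) * (2 - Real.exp (8 * s / N)) := by gcongr; linarith

end MarcinkiewiczZygmund

theorem theorem5p1 :
    -- Markov inequality
    (∀ (a b : ℝ), a < b → ∀ X : BanachFunctionLattice (lebIcc a b), X.RearrangementInvariant →
      ∀ (n r : ℕ) (P : Polynomial ℂ), P.natDegree ≤ n →
        polyFun a b P ∈ X.carrier ∧
        polyFun a b (Polynomial.derivative^[r] P) ∈ X.carrier ∧
        X.nrm (polyFun a b (Polynomial.derivative^[r] P)) ≤
          (8 * (n : ℝ) ^ 2 / (b - a)) ^ r * X.nrm (polyFun a b P)) ∧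
    -- Marcinkiewicz–Zygmund inequality; the constant depends on `ε` only
    (∀ ε : ℝ, 0 < ε → ∃ C : ℝ, 0 < C ∧
      ∀ (a b : ℝ), a < b → ∀ X : BanachFunctionLattice (lebIcc a b), X.RearrangementInvariant →
        ∀ (n N : ℕ), 0 < N → (8 / Real.log 2 + ε) * (n : ℝ) ^ 2 ≤ (N : ℝ) →
          ∀ x : ℕ → ℝ, (∀ k ∈ Finset.Icc 1 N, x k ∈ subInterval a b N k) →
            ∀ P : Polynomial ℂ, P.natDegree ≤ n →
              polyFun a b P ∈ X.carrier ∧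
              sampleFun a b N x P ∈ X.carrier ∧
              X.nrm (polyFun a b P) ≤ C * X.nrm (sampleFun a b N x P) ∧
              X.nrm (sampleFun a b N x P) ≤ C * X.nrm (polyFun a b P)) := by
  refine ⟨fun a b hab X hX n r P hP => ⟨(mem_realEval P).2, (mem_realEval _).2, ?_⟩,
    fun ε hε => ?_⟩
  · rw [nrm_polyFun, nrm_polyFun]
    exact normOf_iterate_derivative_le hab hX r hP
  obtain ⟨C, hC, hexp⟩ := exists_forall_exp_le_and_one_le_mul_two_sub_exp hε
  refine ⟨C, hC, fun a b hab X hX n N hN hnN x hx P hP =>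
    ⟨(mem_realEval P).2, (mem_sampleStep N x P).2, ?_⟩⟩
  obtain ⟨hupper, hlower⟩ := hexp _ _ (Nat.cast_pos.2 hN) hnN
  have hnonneg := BanachFunctionLattice.normOf_nonneg (mem_realEval (X := X) P)
  rw [nrm_polyFun, nrm_sampleFun]
  constructor
  · calc X.normOf (realEval P)
        ≤ C * (2 - Real.exp (8 * (n : ℝ) ^ 2 / N)) * X.normOf (realEval P) :=
          le_mul_of_one_le_left hnonneg hlower
      _ ≤ C * X.normOf (sampleStep a b N x P) := by
          rw [mul_assoc]
          gcongr
          exact two_sub_exp_mul_normOf_le_normOf_sampleStep hab hX hN hx hP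
  · exact (normOf_sampleStep_le hab hX hN hx hP).trans
      (mul_le_mul_of_nonneg_right hupper hnonneg)
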